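/- Let $(V,\Omega)$ be a finite-dimensional real symplectic vector space of dimension $2n$ and let $j$ be a positive compatible complex structure on it, i.e. a real linear map $j:V\to V$ with $j^2=-1$, $\Omega(jv,jw)=\Omega(v,w)$ and $\Omega(v,jv)>0$ for $v\neq 0$. Regard $V$ as a complex vector space by $(x+iy)v=xv+yj(v)$, with the Hermitian inner product $\langle v,w\rangle_j=\Omega(v,jw)-i\,\Omega(v,w)$ (linear in $v$, antilinear in $w$) and $|v|_j^2=\langle v,v\rangle_j$. Fix $\hbar>0$ and put $h=2\pi\hbar$. Let $\mathcal H(V,\Omega,j)$ be the Hilbert space of holomorphic functions $f$ on $(V,\Omega,j)$ with $$\|f\|_j^2=h^{-n}\int_V|f(z)|^2e^{-|z|_j^2/2\hbar}\,dz<\infty,$$ where $dz$ is the Lebesgue measure normalised by $|\cdot|_j$, and let $(f_1,f_2)_j$ be its inner product, linear in $f_1$. For $v\in V$ let $e_v(z)=e^{\frac1{2\hbar}\langle z,v\rangle_j}$ be the coherent states. The Berezin kernel of an operator $A$ on $\mathcal H(V,\Omega,j)$ is $A(z,v)=(Ae_v)(z)$. Let $H(V,\Omega)=V\times\mathbb R$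 be the Heisenberg group, with multiplication $(v_1,t_1)(v_2,t_2)=(v_1+v_2,\,t_1+t_2-\tfrac12\Omega(v_1,v_2))$, acting unitarily on $\mathcal H(V,\Omega,j)$ by $$(U_j(v,t)f)(z)=e^{-it/\hbar+\langle z,v\rangle_j/2\hbar-|v|_j^2/4\hbar}f(z-v).$$ Let $Mp^{c}(V,\Omega,j)$ be the group of pairs $(U,g)$ with $U$ a unitary transformation of $\mathcal H(V,\Omega,j)$ and $g\in Sp(V,\Omega)$ such that $U_j(gv,t)=U\,U_j(v,t)\,U^{-1}$ for all $(v,t)\in H(V,\Omega)$. For $g\in Sp(V,\Omega)$ put $C_g=\tfrac12(g-jgj)$ (which is complex linear and invertible), $D_g=\tfrac12(g+jgj)$ and $Z_g=C_g^{-1}D_g$. **Theorem.** If $(U,g)\in Mp^{c}(V,\Omega,j)$, then there is $\lambda\in\mathbb C$ such that for all $z,v\in V$ the Berezin kernel of $U$ is $$U(z,v)=\lambda\exp\frac1{4\hbar}\left\{2\langle C_g^{-1}z,v\rangle_j-\langle z,Z_{g^{-1}}z\rangle_j-\langle Z_gv,v\rangle_j\right\},$$ and $|\lambda^2\det C_g|=1$,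 where $\det$ is the complex determinant on $(V,\Omega,j)$. Moreover $\lambda=(Ue_0)(0)=(Ue_0,e_0)_j$. -/

import Mathlib

noncomputable section

namespace MpcFock

open MeasureTheory

/-! ### Symplectic vector spaces and positive compatible complex structures -/

/-- A symplectic form on a real vector space: an alternating nondegenerate bilinear form. -/
structure SymplecticForm (V : Type*) [AddCommGroup V] [Module ℝ V] where
  form : LinearMap.BilinForm ℝ V
  alt : form.IsAlt
  nondegenerate : form.Nondegenerate

variable {V : Type*} [AddCommGroup V] [Module ℝ V]

theorem SymplecticForm.neg_swap (Ω : SymplecticForm V) (v w : V) :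
    Ω.form v w = - Ω.form w v :=
  (LinearMap.IsAlt.neg Ω.alt w v).symm

/-- Positive compatible complex structures `j` on `(V, Ω)`. -/
structure PCCS (Ω : SymplecticForm V) where
  j : V →ₗ[ℝ] V
  symp : ∀ v w, Ω.form (j v) (j w) = Ω.form v w
  sq : ∀ v, j (j v) = -v
  pos : ∀ v, v ≠ 0 → 0 < Ω.form v (j v)

/-- The symplectic group `Sp(V, Ω)`. -/
def Sp (Ω : SymplecticForm V) : Subgroup (V ≃ₗ[ℝ] V) where
  carrier := {g | ∀ v w, Ω.form (g v) (g w) = Ω.form v w}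
  one_mem' := fun _ _ => rfl
  mul_mem' := by
    intro a b ha hb v w
    exact (ha (b v) (b w)).trans (hb v w)
  inv_mem' := by
    intro a ha v w
    have h := ha (a⁻¹ v) (a⁻¹ w)
    have e : ∀ x, a (a⁻¹ x) = x := fun x => a.apply_symm_apply x
    rw [e, e] at h
    exact h.symm

variable {Ω : SymplecticForm V}

theorem PCCS.symm (J : PCCS Ω) (v w : V) : Ω.form v (J.j w) = Ω.form w (J.j v) := by
  have h := J.symp v (J.j w)
  rw [J.sq w] at h
  rw [← h, Ω.neg_swap]
  simp

theorem PCCS.j_left (J : PCCS Ω) (v w : V) : Ω.form (J.j v) w = - Ω.form v (J.j w) := by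
  rw [Ω.neg_swap, J.symm w v]

/-- The real vector space `V`, regarded as a complex vector space `(V, Ω, j)` by means of `j`. -/
@[nolint unusedArguments]
def CVec (_J : PCCS Ω) : Type _ := V

namespace CVec

instance (J : PCCS Ω) : AddCommGroup (CVec J) := inferInstanceAs (AddCommGroup V)

/-- The identity map `V → (V, Ω, j)`. -/
def of (J : PCCS Ω) : V ≃+ CVec J := AddEquiv.refl V

variable {J : PCCS Ω}

/-- The identity map `(V, Ω, j) → V`. -/
def toV (v : CVec J) : V := (of J).symm v

@[simp] theorem toV_of (v : V) : (of J v).toV = v := rfl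

@[simp] theorem of_toV (v : CVec J) : of J v.toV = v := rfl

@[simp] theorem toV_add (v w : CVec J) : (v + w).toV = v.toV + w.toV := rfl

@[simp] theorem toV_zero : (0 : CVec J).toV = 0 := rfl

theorem toV_injective {v w : CVec J} (h : v.toV = w.toV) : v = w := h

/-- `(x + iy) v = x v + y j(v)`. -/
instance : SMul ℂ (CVec J) := ⟨fun c v => of J (c.re • v.toV + c.im • J.j v.toV)⟩

theorem toV_smul (c : ℂ) (v : CVec J) : (c • v).toV = c.re • v.toV + c.im • J.j v.toV := rfl

instance : Module ℂ (CVec J) where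
  one_smul v := toV_injective (by simp [toV_smul])
  mul_smul a b v := toV_injective (by
    simp only [toV_smul, map_add, map_smul, J.sq, Complex.mul_re, Complex.mul_im]
    module)
  smul_zero a := toV_injective (by simp [toV_smul])
  smul_add a v w := toV_injective (by
    simp only [toV_smul, toV_add, map_add]
    module)
  add_smul a b v := toV_injective (by
    simp only [toV_smul, toV_add, Complex.add_re, Complex.add_im]
    module)
  zero_smul v := toV_injective (by simp [toV_smul])

end CVec

/-- The Hermitian structure `⟨v, w⟩_j = Ω(v, jw) - i Ω(v, w)`, complex linear in `v` and
antilinear in `w`. -/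
def PCCS.herm (J : PCCS Ω) (v w : CVec J) : ℂ :=
  (Ω.form v.toV (J.j w.toV) : ℂ) - Complex.I * (Ω.form v.toV w.toV : ℂ)

theorem PCCS.herm_add_left (J : PCCS Ω) (u v w : CVec J) :
    J.herm (u + v) w = J.herm u w + J.herm v w := by
  simp only [PCCS.herm, CVec.toV_add, map_add, LinearMap.add_apply]
  push_cast
  ring

theorem PCCS.herm_conj (J : PCCS Ω) (v w : CVec J) :
    starRingEnd ℂ (J.herm v w) = J.herm w v := by
  simp only [PCCS.herm, map_sub, map_mul, Complex.conj_ofReal, Complex.conj_I]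
  rw [J.symm v.toV w.toV, Ω.neg_swap v.toV w.toV]
  push_cast
  ring

theorem PCCS.herm_smul_left (J : PCCS Ω) (c : ℂ) (v w : CVec J) :
    J.herm (c • v) w = c * J.herm v w := by
  simp only [PCCS.herm, CVec.toV_smul, map_add, map_smul, LinearMap.add_apply,
    LinearMap.smul_apply, smul_eq_mul, J.j_left, J.sq, map_neg]
  apply Complex.ext
  · simp
  · simp
    ring

theorem PCCS.herm_self (J : PCCS Ω) (v : CVec J) :
    J.herm v v = (Ω.form v.toV (J.j v.toV) : ℝ) := by
  have h : Ω.form v.toV v.toV = 0 := Ω.alt v.toV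
  simp [PCCS.herm, h]

namespace CVec

variable (J : PCCS Ω)

/-- The complex inner product on `(V, Ω, j)`.  Mathlib's `inner ℂ v w` is antilinear in `v`, so
that it is `⟨w, v⟩_j`. -/
abbrev core : InnerProductSpace.Core ℂ (CVec J) where
  inner v w := J.herm w v
  conj_inner_symm v w := J.herm_conj v w
  re_inner_nonneg v := by
    rw [J.herm_self, RCLike.re_to_complex, Complex.ofReal_re]
    by_cases h : v.toV = 0
    · rw [h]; simp
    · exact (J.pos _ h).le
  add_left u v w := by
    rw [← J.herm_conj (u + v) w, ← J.herm_conj u w, ← J.herm_conj v w, ← map_add,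
      J.herm_add_left]
  smul_left v w c := by
    rw [← J.herm_conj (c • v) w, ← J.herm_conj v w, ← map_mul, J.herm_smul_left]
  definite v h := by
    by_contra hv
    have h1 := J.pos v.toV hv
    rw [J.herm_self] at h
    exact h1.ne' (by exact_mod_cast h)

instance : NormedAddCommGroup (CVec J) := (core J).toNormedAddCommGroup

instance : InnerProductSpace ℂ (CVec J) := InnerProductSpace.ofCore (core J).toCore

/-- The underlying real inner product `Re ⟨v, w⟩_j = Ω(v, jw)`.  It determines the norm `|·|_j` and
the Lebesgue measure `volume` on `(V, Ω, j)` (unit cubes have volume one). -/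
instance : InnerProductSpace ℝ (CVec J) := InnerProductSpace.complexToReal

theorem inner_eq (v w : CVec J) : inner ℂ v w = J.herm w v := rfl

/-- The identity map `V → (V, Ω, j)` is real linear. -/
def ofₗ : V →ₗ[ℝ] CVec J where
  toFun := of J
  map_add' := map_add _
  map_smul' r v := by
    change of J (r • v) = of J ((r : ℂ).re • v + (r : ℂ).im • J.j v)
    simp

instance [FiniteDimensional ℝ V] : FiniteDimensional ℂ (CVec J) := by
  have : FiniteDimensional ℝ (CVec J) :=
    FiniteDimensional.of_surjective (ofₗ J) (of J).surjective
  exact FiniteDimensional.right ℝ ℂ (CVec J)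

instance : MeasurableSpace (CVec J) := borel _

instance : BorelSpace (CVec J) := ⟨rfl⟩

end CVec

section Fock

variable (J : PCCS Ω) (ħ : ℝ)

/-- The Gaussian weight `exp(-|z|²/2ħ)`. -/
def weight (z : CVec J) : ℝ := Real.exp (-‖z‖ ^ 2 / (2 * ħ))

theorem weight_pos (z : CVec J) : 0 < weight J ħ z := Real.exp_pos _

/-- The normalising factor `h⁻ⁿ` with `h = 2πħ` and `n = dim_ℂ (V, j)`. -/
def normConst : ℝ := ((2 * Real.pi * ħ) ^ Module.finrank ℂ (CVec J))⁻¹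

theorem normConst_pos [Fact (0 < ħ)] : 0 < normConst J ħ := by
  have : 0 < ħ := Fact.out
  unfold normConst
  positivity

variable [FiniteDimensional ℝ V]

/-- Holomorphic functions `f` on `(V, Ω, j)` such that `∫ |f(z)|² exp(-|z|²/2ħ) dz` is finite. -/
def fockSubmodule : Submodule ℂ (CVec J → ℂ) where
  carrier := {f | Differentiable ℂ f ∧
    Integrable (fun z => ‖f z‖ ^ 2 * weight J ħ z) (volume : Measure (CVec J))}
  zero_mem' := ⟨differentiable_const 0, by simp⟩
  add_mem' := by
    rintro f g ⟨hf, hf2⟩ ⟨hg, hg2⟩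
    refine ⟨hf.add hg, ((hf2.add hg2).const_mul 2).mono' ?_ (ae_of_all _ fun z => ?_)⟩
    · have := (hf.add hg).continuous
      have hw : Continuous (weight J ħ) := by unfold weight; fun_prop
      exact ((this.norm.pow 2).mul hw).aestronglyMeasurable
    · have hw : 0 < weight J ħ z := Real.exp_pos _
      rw [Real.norm_of_nonneg (by positivity)]
      have h1 : ‖(f + g) z‖ ≤ ‖f z‖ + ‖g z‖ := norm_add_le _ _
      have h2 : ‖(f + g) z‖ ^ 2 ≤ 2 * (‖f z‖ ^ 2 + ‖g z‖ ^ 2) := by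
        nlinarith [sq_nonneg (‖f z‖ - ‖g z‖), norm_nonneg ((f + g) z)]
      calc _ ≤ 2 * (‖f z‖ ^ 2 + ‖g z‖ ^ 2) * weight J ħ z := by gcongr
        _ = _ := by simp only [Pi.add_apply]; ring
  smul_mem' := by
    rintro c f ⟨hf, hf2⟩
    refine ⟨hf.const_smul c, (hf2.const_mul (‖c‖ ^ 2)).congr (ae_of_all _ fun z => ?_)⟩
    simp only [Pi.smul_apply, norm_smul]
    ring

/-- The Fock space `ℋ(V, Ω, j)`. -/
def FockSpace : Type _ := fockSubmodule J ħ

namespace FockSpace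

instance : AddCommGroup (FockSpace J ħ) := inferInstanceAs (AddCommGroup (fockSubmodule J ħ))

instance : Module ℂ (FockSpace J ħ) := inferInstanceAs (Module ℂ (fockSubmodule J ħ))

variable {J ħ}

/-- The holomorphic function underlying an element of the Fock space. -/
def toFun (f : FockSpace J ħ) : CVec J → ℂ := Subtype.val (p := (· ∈ fockSubmodule J ħ)) f

instance : CoeFun (FockSpace J ħ) (fun _ => CVec J → ℂ) := ⟨toFun⟩

@[ext] theorem ext {f g : FockSpace J ħ} (h : ∀ z, f z = g z) : f = g :=
  Subtype.ext (funext h)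

@[simp] theorem add_apply (f g : FockSpace J ħ) (z : CVec J) : (f + g) z = f z + g z := rfl

@[simp] theorem smul_apply (c : ℂ) (f : FockSpace J ħ) (z : CVec J) : (c • f) z = c * f z := rfl

@[simp] theorem zero_apply (z : CVec J) : (0 : FockSpace J ħ) z = 0 := rfl

theorem differentiable (f : FockSpace J ħ) : Differentiable ℂ (f : CVec J → ℂ) := f.2.1

theorem integrable_sq (f : FockSpace J ħ) :
    Integrable (fun z => ‖f z‖ ^ 2 * weight J ħ z) (volume : Measure (CVec J)) := f.2.2

theorem integrable_mul (f g : FockSpace J ħ) :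
    Integrable (fun z => f z * starRingEnd ℂ (g z) * (weight J ħ z : ℂ))
      (volume : Measure (CVec J)) := by
  refine (f.integrable_sq.add g.integrable_sq).mono' ?_ (ae_of_all _ fun z => ?_)
  · have h1 := f.differentiable.continuous
    have h2 := g.differentiable.continuous
    have hw : Continuous (weight J ħ) := by unfold weight; fun_prop
    exact ((h1.mul (Complex.continuous_conj.comp h2)).mul
      (Complex.continuous_ofReal.comp hw)).aestronglyMeasurable
  · have hw : 0 < weight J ħ z := Real.exp_pos _
    simp only [norm_mul, RCLike.norm_conj, Complex.norm_real, Real.norm_of_nonneg hw.le,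
      Pi.add_apply]
    rw [← add_mul]
    gcongr
    nlinarith [sq_nonneg (‖f z‖ - ‖g z‖), sq_nonneg ‖f z‖, sq_nonneg ‖g z‖]

/-- The inner product `(f₁, f₂)_j = h⁻ⁿ ∫ f₁(z) \overline{f₂(z)} exp(-|z|²/2ħ) dz`, linear in `f₁`
and antilinear in `f₂`.  Here `volume` is the Lebesgue measure of the Hermitian norm `|·|_j`. -/
def ip (f₁ f₂ : FockSpace J ħ) : ℂ :=
  (normConst J ħ : ℂ) * ∫ z : CVec J, f₁ z * starRingEnd ℂ (f₂ z) * (weight J ħ z : ℂ)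

theorem ip_self (f : FockSpace J ħ) :
    ip f f = ((normConst J ħ * ∫ z : CVec J, ‖f z‖ ^ 2 * weight J ħ z : ℝ) : ℂ) := by
  rw [ip, Complex.ofReal_mul, ← integral_complex_ofReal]
  congr 2
  funext z
  rw [Complex.mul_conj']
  push_cast
  ring

variable [Fact (0 < ħ)]

/-- Mathlib's `inner ℂ f g` is antilinear in `f`, so that it is `(g, f)_j`. -/
abbrev core : InnerProductSpace.Core ℂ (FockSpace J ħ) where
  inner f g := ip g f
  conj_inner_symm f g := by
    simp only [ip, map_mul, Complex.conj_ofReal]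
    rw [← integral_conj]
    congr 2
    funext z
    simp only [map_mul, Complex.conj_conj, Complex.conj_ofReal]
    ring
  re_inner_nonneg f := by
    rw [ip_self]
    have := normConst_pos J ħ
    simp only [RCLike.re_to_complex, Complex.ofReal_re]
    have : 0 ≤ ∫ z : CVec J, ‖f z‖ ^ 2 * weight J ħ z :=
      integral_nonneg fun z => mul_nonneg (sq_nonneg _) (Real.exp_pos _).le
    positivity
  add_left f g k := by
    simp only [ip]
    rw [← mul_add, ← integral_add (integrable_mul k f) (integrable_mul k g)]
    congr 2
    funext z
    simp only [add_apply, map_add]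
    ring
  smul_left f g c := by
    simp only [ip]
    rw [mul_left_comm]
    congr 1
    rw [← integral_const_mul]
    congr 1
    funext z
    simp only [smul_apply, map_mul]
    ring
  definite f h := by
    rw [ip_self] at h
    have h0 := normConst_pos J ħ
    have h1 : ∫ z : CVec J, ‖f z‖ ^ 2 * weight J ħ z = 0 := by
      have : normConst J ħ * ∫ z : CVec J, ‖f z‖ ^ 2 * weight J ħ z = 0 := by exact_mod_cast h
      exact (mul_eq_zero.mp this).resolve_left h0.ne'
    have hw : Continuous (weight J ħ) := by unfold weight; fun_prop
    have hc : Continuous fun z : CVec J => ‖f z‖ ^ 2 * weight J ħ z :=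
      (f.differentiable.continuous.norm.pow 2).mul hw
    rw [integral_eq_zero_iff_of_nonneg
      (fun z => mul_nonneg (sq_nonneg _) (weight_pos J ħ z).le) f.integrable_sq,
      hc.ae_eq_iff_eq volume continuous_zero] at h1
    ext z
    have h2 := congrFun h1 z
    have hz : weight J ħ z ≠ 0 := (Real.exp_pos _).ne'
    simpa [hz] using h2

instance : NormedAddCommGroup (FockSpace J ħ) :=
  (core (J := J) (ħ := ħ)).toNormedAddCommGroup

instance : InnerProductSpace ℂ (FockSpace J ħ) := 
  InnerProductSpace.ofCore (core (J := J) (ħ := ħ)).toCore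

theorem norm_sq (f : FockSpace J ħ) :
    ‖f‖ ^ 2 = normConst J ħ * ∫ z : CVec J, ‖f z‖ ^ 2 * weight J ħ z := by
  have h : ‖f‖ ^ 2 = (ip f f).re := InnerProductSpace.norm_sq_eq_re_inner (𝕜 := ℂ) f
  rw [h, ip_self, Complex.ofReal_re]

end FockSpace

/-! ### Coherent states and the Heisenberg group -/

variable [Fact (0 < ħ)]

theorem coherent_mem (v : CVec J) :
    (fun z : CVec J => Complex.exp (1 / (2 * ħ) * J.herm z v)) ∈ fockSubmodule J ħ := by
  have hħ : 0 < ħ := Fact.out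
  have hd : Differentiable ℂ fun z : CVec J => J.herm z v := (innerSL ℂ v).differentiable
  refine ⟨(hd.const_mul _).cexp, ?_⟩
  have h := (GaussianFourier.integrable_cexp_neg_mul_sq_norm_add (V := CVec J)
    (b := ((1 / (2 * ħ) : ℝ) : ℂ)) (by rw [Complex.ofReal_re]; positivity)
    ((1 / ħ : ℝ) : ℂ) v).norm
  refine h.congr (ae_of_all _ fun z => ?_)
  have e : inner ℝ v z = (J.herm z v).re := rfl
  simp only [weight, Complex.norm_exp, e]
  rw [← Real.exp_nat_mul, ← Real.exp_add]
  congr 1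
  have e1 : (1 / (2 * (ħ : ℂ)) * J.herm z v).re = 1 / (2 * ħ) * (J.herm z v).re := by
    rw [← Complex.re_ofReal_mul]; push_cast; rfl
  have e2 : (-((1 / (2 * ħ) : ℝ) : ℂ) * (‖z‖ : ℂ) ^ 2
      + ((1 / ħ : ℝ) : ℂ) * ((J.herm z v).re : ℂ)).re
      = -(1 / (2 * ħ)) * ‖z‖ ^ 2 + 1 / ħ * (J.herm z v).re := by
    rw [← Complex.ofReal_re (-(1 / (2 * ħ)) * ‖z‖ ^ 2 + 1 / ħ * (J.herm z v).re)]
    push_cast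
    rfl
  rw [e1, e2]
  push_cast
  field_simp
  ring

/-- The coherent states `e_v(z) = exp(⟨z, v⟩_j / 2ħ)`. -/
def coherent (v : CVec J) : FockSpace J ħ :=
  ⟨fun z => Complex.exp (1 / (2 * ħ) * J.herm z v), coherent_mem J ħ v⟩

end Fock

/-- The Heisenberg group `H(V, Ω)`, with underlying set `V × ℝ`. -/
@[ext] structure Heisenberg (Ω : SymplecticForm V) where
  vec : V
  t : ℝ

namespace Heisenberg

/-- `(v₁, t₁)(v₂, t₂) = (v₁ + v₂, t₁ + t₂ - ½ Ω(v₁, v₂))`. -/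
instance : Mul (Heisenberg Ω) :=
  ⟨fun x y => ⟨x.vec + y.vec, x.t + y.t - 1 / 2 * Ω.form x.vec y.vec⟩⟩

instance : One (Heisenberg Ω) := ⟨⟨0, 0⟩⟩

instance : Inv (Heisenberg Ω) := ⟨fun x => ⟨-x.vec, -x.t⟩⟩

@[simp] theorem mul_vec (x y : Heisenberg Ω) : (x * y).vec = x.vec + y.vec := rfl
@[simp] theorem mul_t (x y : Heisenberg Ω) :
    (x * y).t = x.t + y.t - 1 / 2 * Ω.form x.vec y.vec := rfl
@[simp] theorem one_vec : (1 : Heisenberg Ω).vec = 0 := rfl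
@[simp] theorem one_t : (1 : Heisenberg Ω).t = 0 := rfl
@[simp] theorem inv_vec (x : Heisenberg Ω) : x⁻¹.vec = -x.vec := rfl
@[simp] theorem inv_t (x : Heisenberg Ω) : x⁻¹.t = -x.t := rfl

instance : Group (Heisenberg Ω) :=
  Group.ofLeftAxioms
    (fun x y z => by
      ext
      · simp [add_assoc]
      · simp
        ring)
    (fun x => by ext <;> simp)
    (fun x => by
      ext
      · simp
      · have h : Ω.form x.vec x.vec = 0 := Ω.alt x.vec
        simp [h])

/-- The action `g · (v, t) = (g v, t)` of `Sp(V, Ω)` on the Heisenberg group. -/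
instance : SMul (Sp Ω) (Heisenberg Ω) := ⟨fun g x => ⟨(g : V ≃ₗ[ℝ] V) x.vec, x.t⟩⟩

theorem smul_def (g : Sp Ω) (x : Heisenberg Ω) : g • x = ⟨(g : V ≃ₗ[ℝ] V) x.vec, x.t⟩ := rfl

end Heisenberg

section Rep

variable (J : PCCS Ω) (ħ : ℝ)

/-- The multiplier `exp(-it/ħ + ⟨z, v⟩_j / 2ħ - |v|²/4ħ)` of the Fock representation. -/
def multiplier (x : Heisenberg Ω) (z : CVec J) : ℂ :=
  Complex.exp (-Complex.I * x.t / ħ + J.herm z (CVec.of J x.vec) / (2 * ħ)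
    - (‖CVec.of J x.vec‖ : ℂ) ^ 2 / (4 * ħ))

variable {J ħ} in
theorem norm_multiplier_sq_mul_weight (hħ : 0 < ħ) (x : Heisenberg Ω) (z : CVec J) :
    ‖multiplier J ħ x z‖ ^ 2 * weight J ħ z = weight J ħ (z - CVec.of J x.vec) := by
  set v := CVec.of J x.vec with hv
  have e : (J.herm z v).re = inner ℝ v z := rfl
  have e1 : (-Complex.I * x.t / ħ + J.herm z v / (2 * ħ) - (‖v‖ : ℂ) ^ 2 / (4 * ħ)).re
      = inner ℝ v z / (2 * ħ) - ‖v‖ ^ 2 / (4 * ħ) := by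
    rw [← e]
    have h1 : (-Complex.I * x.t / ħ).re = 0 := by
      rw [Complex.div_ofReal_re]; simp
    have h2 : (J.herm z v / (2 * ħ)).re = (J.herm z v).re / (2 * ħ) := by
      rw [← Complex.div_ofReal_re]; push_cast; rfl
    have h3 : ((‖v‖ : ℂ) ^ 2 / (4 * ħ)).re = ‖v‖ ^ 2 / (4 * ħ) := by
      rw [← Complex.ofReal_re (‖v‖ ^ 2 / (4 * ħ))]; push_cast; rfl
    rw [Complex.sub_re, Complex.add_re, h1, h2, h3, zero_add]
  rw [multiplier, ← hv, Complex.norm_exp, e1, weight, weight, ← Real.exp_nat_mul, ← Real.exp_add,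
    norm_sub_sq_real, real_inner_comm v z]
  congr 1
  push_cast
  field_simp
  ring

variable {J ħ} in
theorem multiplier_mul (hħ : 0 < ħ) (x y : Heisenberg Ω) (z : CVec J) :
    multiplier J ħ (x * y) z
      = multiplier J ħ x z * multiplier J ħ y (z - CVec.of J x.vec) := by
  have hc : (ħ : ℂ) ≠ 0 := by exact_mod_cast hħ.ne'
  have hn : ∀ v : CVec J, (‖v‖ : ℂ) ^ 2 = J.herm v v := fun v => by
    rw [← CVec.inner_eq, inner_self_eq_norm_sq_to_K]; rfl
  have hl : ∀ a b c : CVec J, J.herm (a - b) c = J.herm a c - J.herm b c := fun a b c => by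
    simp only [← CVec.inner_eq, inner_sub_right]
  have hr : ∀ a b c : CVec J, J.herm a (b + c) = J.herm a b + J.herm a c := fun a b c => by
    simp only [← CVec.inner_eq, inner_add_left]
  have hs : J.herm (CVec.of J x.vec) (CVec.of J y.vec)
      = J.herm (CVec.of J y.vec) (CVec.of J x.vec)
        - 2 * Complex.I * (Ω.form x.vec y.vec : ℂ) := by
    simp only [PCCS.herm, CVec.toV_of]
    rw [J.symm y.vec x.vec, Ω.neg_swap y.vec x.vec]
    push_cast
    ring
  simp only [multiplier, hn]
  rw [← Complex.exp_add]
  congr 1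
  simp only [Heisenberg.mul_vec, Heisenberg.mul_t, map_add, hr, hl, J.herm_add_left, hs]
  push_cast
  field_simp
  ring

variable [FiniteDimensional ℝ V] [Fact (0 < ħ)]

theorem rep_mem (x : Heisenberg Ω) (f : FockSpace J ħ) :
    (fun z : CVec J => multiplier J ħ x z * f (z - CVec.of J x.vec)) ∈ fockSubmodule J ħ := by
  have hħ : 0 < ħ := Fact.out
  constructor
  · have hd : Differentiable ℂ fun z : CVec J => J.herm z (CVec.of J x.vec) :=
      (innerSL ℂ (CVec.of J x.vec)).differentiable
    have hm : Differentiable ℂ (multiplier J ħ x) := by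
      unfold multiplier
      fun_prop
    exact hm.mul (f.differentiable.comp (differentiable_id.sub_const _))
  · refine (f.integrable_sq.comp_sub_right (CVec.of J x.vec)).congr (ae_of_all _ fun z => ?_)
    simp only [norm_mul, mul_pow, ← norm_multiplier_sq_mul_weight hħ]
    ring

/-- The operator `U_j(v, t)` on the Fock space,
`(U_j(v, t) f)(z) = exp(-it/ħ + ⟨z, v⟩_j / 2ħ - |v|²/4ħ) f(z - v)`. -/
def repLin (x : Heisenberg Ω) : FockSpace J ħ →ₗ[ℂ] FockSpace J ħ where
  toFun f := ⟨fun z => multiplier J ħ x z * f (z - CVec.of J x.vec), rep_mem J ħ x f⟩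
  map_add' f g := by
    ext z
    exact mul_add _ _ _
  map_smul' c f := by
    ext z
    exact mul_left_comm _ _ _

theorem repLin_apply (x : Heisenberg Ω) (f : FockSpace J ħ) (z : CVec J) :
    repLin J ħ x f z = multiplier J ħ x z * f (z - CVec.of J x.vec) := rfl

theorem repLin_mul (x y : Heisenberg Ω) (f : FockSpace J ħ) :
    repLin J ħ (x * y) f = repLin J ħ x (repLin J ħ y f) := by
  ext z
  rw [repLin_apply, repLin_apply, repLin_apply, multiplier_mul Fact.out, Heisenberg.mul_vec,
    map_add, sub_sub, mul_assoc]

theorem repLin_one (f : FockSpace J ħ) : repLin J ħ 1 f = f := by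
  ext z
  have h : J.herm z 0 = 0 := by rw [← CVec.inner_eq, inner_zero_left]
  rw [repLin_apply]
  simp [multiplier, h]

theorem norm_repLin (x : Heisenberg Ω) (f : FockSpace J ħ) : ‖repLin J ħ x f‖ = ‖f‖ := by
  rw [← sq_eq_sq₀ (norm_nonneg _) (norm_nonneg _), FockSpace.norm_sq, FockSpace.norm_sq]
  congr 1
  rw [← integral_sub_right_eq_self (fun z : CVec J => ‖f z‖ ^ 2 * weight J ħ z)
    (CVec.of J x.vec)]
  congr 1
  funext z
  rw [repLin_apply, norm_mul, mul_pow, ← norm_multiplier_sq_mul_weight Fact.out]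
  ring

/-- The unitary representation `U_j` of the Heisenberg group on the Fock space. -/
def rep : Heisenberg Ω →* (FockSpace J ħ ≃ₗᵢ[ℂ] FockSpace J ħ) where
  toFun x :=
    { repLin J ħ x with
      invFun := repLin J ħ x⁻¹
      left_inv := fun f => by
        change repLin J ħ x⁻¹ (repLin J ħ x f) = f
        rw [← repLin_mul, inv_mul_cancel, repLin_one]
      right_inv := fun f => by
        change repLin J ħ x (repLin J ħ x⁻¹ f) = f
        rw [← repLin_mul, mul_inv_cancel, repLin_one]
      norm_map' := norm_repLin J ħ x }
  map_one' := LinearIsometryEquiv.ext (repLin_one J ħ)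
  map_mul' x y := LinearIsometryEquiv.ext (repLin_mul J ħ x y)

theorem rep_apply (x : Heisenberg Ω) (f : FockSpace J ħ) (z : CVec J) :
    rep J ħ x f z = multiplier J ħ x z * f (z - CVec.of J x.vec) := rfl

/-- The group `Mp^c(V, Ω, j)` of pairs `(U, g)` with `U` a unitary transformation of the Fock
space and `g ∈ Sp(V, Ω)` such that `U_j(g · x) = U U_j(x) U⁻¹` for all `x ∈ H(V, Ω)`. -/
def Mpc : Subgroup ((FockSpace J ħ ≃ₗᵢ[ℂ] FockSpace J ħ) × Sp Ω) where
  carrier := {p | ∀ x : Heisenberg Ω, rep J ħ (p.2 • x) = p.1 * rep J ħ x * p.1⁻¹}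
  one_mem' := fun x => by simp [Heisenberg.smul_def]
  mul_mem' := by
    intro p q hp hq x
    have h : (p * q).2 • x = p.2 • (q.2 • x) := rfl
    rw [h, hp, hq, Prod.fst_mul]
    group
  inv_mem' := by
    intro p hp x
    have h : p.2 • ((p⁻¹).2 • x) = x := by
      have e : (p.2 * p.2⁻¹) • x = p.2 • ((p⁻¹).2 • x) := rfl
      rw [← e, mul_inv_cancel]
      rfl
    have h2 := hp ((p⁻¹).2 • x)
    rw [h] at h2
    rw [h2, Prod.fst_inv]
    group

/-- The Berezin kernel `A(z, w) = (A e_w)(z)` of an operator on the Fock space. -/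
def berezinKernel (A : FockSpace J ħ →ₗ[ℂ] FockSpace J ħ) (z w : CVec J) : ℂ :=
  A (coherent J ħ w) z

end Rep

/-! ### The parameters `C_g` and `Z_g` of `g ∈ Sp(V, Ω)` -/

section Parameters

variable (J : PCCS Ω)

/-- The complex linear part `C_g = ½ (g - j g j)`. -/
def cPart (g : V ≃ₗ[ℝ] V) : CVec J →ₗ[ℂ] CVec J where
  toFun v := CVec.of J ((1 / 2 : ℝ) • (g v.toV - J.j (g (J.j v.toV))))
  map_add' v w := CVec.toV_injective (by
    simp only [CVec.toV_of, CVec.toV_add, map_add]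
    module)
  map_smul' c v := CVec.toV_injective (by
    simp only [CVec.toV_of, CVec.toV_smul, RingHom.id_apply, map_add, map_sub, map_smul, J.sq,
      map_neg]
    module)

/-- The complex antilinear part `D_g = ½ (g + j g j)`. -/
def dPart (g : V ≃ₗ[ℝ] V) : CVec J →ₗ⋆[ℂ] CVec J where
  toFun v := CVec.of J ((1 / 2 : ℝ) • (g v.toV + J.j (g (J.j v.toV))))
  map_add' v w := CVec.toV_injective (by
    simp only [CVec.toV_of, CVec.toV_add, map_add]
    module)
  map_smul' c v := CVec.toV_injective (by
    simp only [CVec.toV_of, CVec.toV_smul, map_add, map_smul, J.sq, Complex.conj_re,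
      Complex.conj_im, map_neg]
    module)

theorem cPart_injective (g : Sp Ω) : Function.Injective (cPart J g) := by
  rw [← LinearMap.ker_eq_bot, LinearMap.ker_eq_bot']
  intro v hv
  by_contra h0
  have h0' : v.toV ≠ 0 := h0
  set u := v.toV with hu
  have hj : J.j u ≠ 0 := fun h => h0' (by
    have := J.sq u
    rw [h, map_zero] at this
    exact neg_eq_zero.mp this.symm)
  have hg : ∀ a b : V, Ω.form ((g : V ≃ₗ[ℝ] V) a) ((g : V ≃ₗ[ℝ] V) b) = Ω.form a b := g.2
  have hgu : (g : V ≃ₗ[ℝ] V) u ≠ 0 := by simpa using h0'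
  have e : (g : V ≃ₗ[ℝ] V) u = J.j ((g : V ≃ₗ[ℝ] V) (J.j u)) := by
    have h1 : (1 / 2 : ℝ) • ((g : V ≃ₗ[ℝ] V) u - J.j ((g : V ≃ₗ[ℝ] V) (J.j u))) = 0 := hv
    exact sub_eq_zero.mp ((smul_eq_zero.mp h1).resolve_left (by norm_num))
  have h1 := J.pos _ hgu
  have h2 := J.pos u h0'
  have h3 : J.j ((g : V ≃ₗ[ℝ] V) u) = - (g : V ≃ₗ[ℝ] V) (J.j u) := by
    conv_lhs => rw [e, J.sq]
  rw [h3, map_neg, hg] at h1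
  linarith

variable [FiniteDimensional ℝ V]

/-- `C_g` is invertible for `g ∈ Sp(V, Ω)`. -/
def cEquiv (g : Sp Ω) : CVec J ≃ₗ[ℂ] CVec J :=
  LinearEquiv.ofInjectiveEndo (cPart J g) (cPart_injective J g)

theorem cEquiv_apply (g : Sp Ω) (v : CVec J) : cEquiv J g v = cPart J g v := rfl

/-- `Z_g = C_g⁻¹ D_g`. -/
def zPart (g : Sp Ω) : CVec J →ₗ⋆[ℂ] CVec J :=
  (cEquiv J g).symm.toLinearMap.comp (dPart J g)

end Parameters

end MpcFock

end

/-!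
Let `φ = U e_0`, and let `C`, `D` be the complex linear and antilinear parts of `g`.

The Heisenberg group acts on coherent states by translation, up to explicit factors, so the
intertwining relation writes every `(U e_w)(z)` as an explicit exponential times `φ (z - g w)`
(`apply_coherent_of_mem_Mpc`). On the other hand the reproducing property `(f, e_v) = f v`
(`ip_coherent`) gives `(U e_w)(z) = conj ((U⁻¹ e_z)(w))`, which is antiholomorphic in `w`
(`apply_coherent_eq_conj`). Vanishing of the complex linear part of the derivative in `w` at `w = 0`
says that `dφ_z(C u) = ⟨z, D u⟩ φ(z) / 2ħ`. As `D C⁻¹ = -Z_{g⁻¹}`, this is a linear differential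
equation whose only solutions are the multiples of the Gaussian `exp (-⟨z, Z_{g⁻¹} z⟩ / 4ħ)`
(`apply_coherent_zero`). Putting it back into the first formula gives the kernel, by the identity
`kernel_exponent`, which rests on `C_{g⁻¹} = C_g*`, on the symmetry of `⟨x, Z_g y⟩` and on
`1 + Z_g = C_g⁻¹ g`.

For the normalisation, `1 = ‖e_0‖² = ‖U e_0‖²` is `|φ 0|²` times the Gaussian integral of the real
quadratic form attached to `1 + Z_{g⁻¹}`. This operator is symmetric and positive since `|Z| < 1`.
Its real determinant is `±|det C_g|⁻²`, because `g` has determinant `±1` and the real determinant of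
a complex linear map is the squared modulus of the complex one (`abs_det_oneAddZ`).
-/

noncomputable section

namespace MpcFock

open MeasureTheory

section Fock

/-! ### Gaussian integrals -/

/-- A positive definite symmetric operator is `T* T` for some `T`, here its square root. -/
theorem exists_inner_eq_norm_sq {E : Type*} [NormedAddCommGroup E] [InnerProductSpace ℝ E]
    [FiniteDimensional ℝ E] {S : E →ₗ[ℝ] E} (hS : S.IsSymmetric)
    (hpos : ∀ x, x ≠ 0 → 0 < inner ℝ (S x) x) :
    ∃ T : E →ₗ[ℝ] E, (∀ x, inner ℝ (S x) x = ‖T x‖ ^ 2) ∧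
      LinearMap.det S = LinearMap.det T ^ 2 ∧ LinearMap.det T ≠ 0 := by
  set b := hS.eigenvectorBasis rfl with hb
  set μ := hS.eigenvalues rfl with hμ
  have hSb : ∀ i, S (b i) = μ i • b i := fun i => hS.apply_eigenvectorBasis rfl i
  have hμpos : ∀ i, 0 < μ i := fun i => by
    have h := hpos (b i) (b.orthonormal.ne_zero i)
    rwa [hSb, real_inner_smul_left, real_inner_self_eq_norm_sq, b.norm_eq_one, one_pow,
      mul_one] at h
  set T : E →ₗ[ℝ] E := b.toBasis.constr ℝ fun i => Real.sqrt (μ i) • b i with hT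
  have hTb : ∀ i, T (b i) = Real.sqrt (μ i) • b i := fun i => by
    have := b.toBasis.constr_basis ℝ (fun i => Real.sqrt (μ i) • b i) i
    rwa [b.coe_toBasis] at this
  have hT2 : S = T * T := by
    refine b.toBasis.ext fun i => ?_
    rw [b.coe_toBasis, hSb, Module.End.mul_apply, hTb, map_smul, hTb, smul_smul,
      Real.mul_self_sqrt (hμpos i).le]
  have hTs : T.IsSymmetric := by
    rw [LinearMap.isSymmetric_iff_isSelfAdjoint, LinearMap.isSelfAdjoint_iff', eq_comm,
      LinearMap.eq_adjoint_iff_basis b.toBasis b.toBasis]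
    intro i j
    simp only [b.coe_toBasis, hTb, real_inner_smul_left, real_inner_smul_right]
    by_cases h : i = j
    · rw [h]
    · rw [b.orthonormal.2 h]; simp
  have hdet : LinearMap.det S = LinearMap.det T ^ 2 := by rw [hT2, map_mul, sq]
  refine ⟨T, fun x => ?_, hdet, fun h0 => ?_⟩
  · rw [hT2, Module.End.mul_apply, hTs, real_inner_self_eq_norm_sq]
  · rw [h0, zero_pow two_ne_zero, LinearMap.det_eq_zero_iff_ker_ne_bot,
      Submodule.ne_bot_iff] at hdet
    obtain ⟨x, hx, hx0⟩ := hdet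
    have := hpos x hx0
    rw [LinearMap.mem_ker.mp hx, inner_zero_left] at this
    exact this.false

/-- The Gaussian integral of a positive definite quadratic form, squared so as to avoid square roots
of determinants. -/
theorem integral_exp_neg_inner {E : Type*} [NormedAddCommGroup E] [InnerProductSpace ℝ E]
    [FiniteDimensional ℝ E] [MeasurableSpace E] [BorelSpace E] {S : E →ₗ[ℝ] E}
    (hS : S.IsSymmetric) (hpos : ∀ x, x ≠ 0 → 0 < inner ℝ (S x) x) {b : ℝ} (hb : 0 < b) :
    (∫ x : E, Real.exp (-b * inner ℝ (S x) x)) ^ 2 * |LinearMap.det S|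
      = (Real.pi / b) ^ Module.finrank ℝ E := by
  obtain ⟨T, hT, hdet, hT0⟩ := exists_inner_eq_norm_sq hS hpos
  have h1 : ∫ x : E, Real.exp (-b * inner ℝ (S x) x)
      = |LinearMap.det T|⁻¹ * ∫ x : E, Real.exp (-b * ‖x‖ ^ 2) := by
    have hm : MeasurableEmbedding T :=
      ((LinearEquiv.ofIsUnitDet (f := T) (v := Module.finBasis ℝ E) (v' := Module.finBasis ℝ E)
        (by rw [LinearMap.det_toMatrix]; exact hT0.isUnit)).toContinuousLinearEquiv.toHomeomorph
          ).measurableEmbedding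
    have h := hm.integral_map (μ := volume) fun x => Real.exp (-b * ‖x‖ ^ 2)
    rw [Measure.map_linearMap_addHaar_eq_smul_addHaar volume hT0, integral_smul_measure,
      ENNReal.toReal_ofReal (abs_nonneg _), abs_inv, smul_eq_mul] at h
    simp only [hT]
    exact h.symm
  rw [h1, GaussianFourier.integral_rexp_neg_mul_sq_norm hb, hdet, abs_pow, mul_pow, mul_right_comm,
    ← mul_pow, inv_mul_cancel₀ (abs_ne_zero.mpr hT0), one_pow, one_mul, ← Real.rpow_natCast,
    ← Real.rpow_mul (by positivity), ← Real.rpow_natCast]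
  congr 1
  push_cast
  ring

/-! ### The reproducing property of the coherent states -/

variable {V : Type*} [AddCommGroup V] [Module ℝ V] {Ω : SymplecticForm V} {J : PCCS Ω} {ħ : ℝ}

theorem herm_zero_right (z : CVec J) : J.herm z 0 = 0 := by
  rw [← CVec.inner_eq, inner_zero_left]

theorem norm_sq_eq_herm (v : CVec J) : (‖v‖ : ℂ) ^ 2 = J.herm v v := by
  rw [← CVec.inner_eq, inner_self_eq_norm_sq_to_K]; rfl

theorem weight_smul {c : ℂ} (hc : ‖c‖ = 1) (z : CVec J) :
    weight J ħ (c • z) = weight J ħ z := by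
  rw [weight, weight, norm_smul, hc, one_mul]

theorem integral_circle_smul (f : CVec J → ℂ) (hf : Differentiable ℂ f) (z : CVec J) :
    ∫ θ in (0 : ℝ)..2 * Real.pi, f (circleMap 0 1 θ • z) = 2 * Real.pi * f 0 := by
  have hd : Differentiable ℂ fun c : ℂ => f (c • z) :=
    hf.comp (differentiable_id.smul_const z)
  have h := (hd.diffContOnCl (s := Metric.ball 0 |1|)).circleAverage
  rw [Real.circleAverage_def, zero_smul] at h
  rw [← h, Complex.real_smul]
  have : (Real.pi : ℂ) ≠ 0 := by exact_mod_cast Real.pi_ne_zero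
  push_cast
  field_simp

variable [FiniteDimensional ℝ V]

theorem normConst_mul_integral_weight (hħ : 0 < ħ) :
    normConst J ħ * ∫ z : CVec J, weight J ħ z = 1 := by
  have e : (fun z : CVec J => weight J ħ z) = fun z => Real.exp (-(1 / (2 * ħ)) * ‖z‖ ^ 2) := by
    funext z
    rw [weight]
    congr 1
    ring
  rw [e, GaussianFourier.integral_rexp_neg_mul_sq_norm (by positivity), normConst,
    finrank_real_of_complex]
  rw [show Real.pi / (1 / (2 * ħ)) = 2 * Real.pi * ħ by field_simp]
  push_cast
  rw [mul_div_cancel_left₀ _ two_ne_zero, Real.rpow_natCast]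
  exact inv_mul_cancel₀ (by positivity)

theorem measurePreserving_smul_of_norm_one {c : ℂ} (hc : ‖c‖ = 1) :
    MeasurePreserving (fun z : CVec J => c • z) := by
  have hc0 : c ≠ 0 := by rintro rfl; simp at hc
  let e : CVec J ≃ₗᵢ[ℝ] CVec J :=
    { (LinearEquiv.smulOfNeZero ℂ (CVec J) c hc0).restrictScalars ℝ with
      norm_map' := fun z => by
        change ‖c • z‖ = ‖z‖
        rw [norm_smul, hc, one_mul] }
  exact e.measurePreserving

theorem integral_comp_smul_of_norm_one {F : Type*} [NormedAddCommGroup F] [NormedSpace ℝ F]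
    {c : ℂ} (hc : ‖c‖ = 1) (h : CVec J → F) : ∫ z, h (c • z) = ∫ z, h z := by
  have hc0 : c ≠ 0 := by rintro rfl; simp at hc
  exact (measurePreserving_smul_of_norm_one hc).integral_comp
    (Homeomorph.smulOfNeZero c hc0).measurableEmbedding h

variable [Fact (0 < ħ)]

@[simp] theorem coherent_zero_apply (z : CVec J) : coherent J ħ 0 z = 1 := by
  change Complex.exp (1 / (2 * ħ) * J.herm z 0) = 1
  rw [herm_zero_right, mul_zero, Complex.exp_zero]

theorem coherent_apply (v z : CVec J) :
    coherent J ħ v z = Complex.exp (1 / (2 * ħ) * J.herm z v) := rfl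

/-- The Gaussian mean of a holomorphic function is its value at the origin, because the Gaussian is
invariant under `z ↦ e^{iθ} z` and the mean over `θ` is the value at the origin already. -/
theorem ip_coherent_zero (f : FockSpace J ħ) : FockSpace.ip f (coherent J ħ 0) = f 0 := by
  have hħ : 0 < ħ := Fact.out
  set F : CVec J → ℂ := fun z => f z * (weight J ħ z : ℂ) with hF
  have hFint : Integrable F := by
    refine (f.integrable_mul (coherent J ħ 0)).congr (ae_of_all _ fun z => ?_)
    simp [hF]
  have hFc : Continuous F := by
    have h1 := f.differentiable.continuous
    have hw : Continuous (weight J ħ) := by unfold weight; fun_prop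
    exact h1.mul (Complex.continuous_ofReal.comp hw)
  have hc : ∀ θ, ‖circleMap 0 1 θ‖ = 1 := fun θ => by simp
  -- Integrate `F (e^{iθ} z)` over `θ` and `z` in both orders.
  set ν := volume.restrict (Set.Ioc (0 : ℝ) (2 * Real.pi)) with hν
  have hGint : Integrable (Function.uncurry fun (θ : ℝ) (z : CVec J) => F (circleMap 0 1 θ • z))
      (ν.prod volume) := by
    have hcont : Continuous
        (Function.uncurry fun (θ : ℝ) (z : CVec J) => F (circleMap 0 1 θ • z)) :=
      hFc.comp (((continuous_circleMap 0 1).comp continuous_fst).smul continuous_snd)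
    rw [integrable_prod_iff hcont.aestronglyMeasurable]
    refine ⟨ae_of_all _ fun θ => ?_, ?_⟩
    · exact (measurePreserving_smul_of_norm_one (hc θ)).integrable_comp_of_integrable hFint
    · simp only [Function.uncurry]
      rw [funext fun θ : ℝ => integral_comp_smul_of_norm_one (hc θ) fun z => ‖F z‖]
      exact integrable_const _
  have h1 : ∫ θ, ∫ z, F (circleMap 0 1 θ • z) ∂volume ∂ν = 2 * Real.pi * ∫ z, F z := by
    rw [funext fun θ : ℝ => integral_comp_smul_of_norm_one (hc θ) F, integral_const, hν]
    simp [Real.pi_pos.le]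
  rw [integral_integral_swap hGint] at h1
  have h2 : ∀ z, ∫ θ, F (circleMap 0 1 θ • z) ∂ν = 2 * Real.pi * f 0 * weight J ħ z := fun z => by
    rw [← integral_circle_smul f f.differentiable z,
      intervalIntegral.integral_of_le (by positivity), ← integral_mul_const]
    simp only [hF, weight_smul (hc _), hν]
  simp only [h2] at h1
  rw [integral_const_mul, integral_complex_ofReal, mul_assoc] at h1
  have h3 := mul_left_cancel₀ (by simp [Real.pi_ne_zero]) h1
  have h4 : FockSpace.ip f (coherent J ħ 0) = normConst J ħ * ∫ z, F z := by
    simp [FockSpace.ip, hF]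
  have h5 : (normConst J ħ : ℂ) * ((∫ z : CVec J, weight J ħ z : ℝ) : ℂ) = 1 := by
    exact_mod_cast normConst_mul_integral_weight hħ
  rw [h4, ← h3, mul_left_comm, h5, mul_one]

theorem ip_isometry (U : FockSpace J ħ ≃ₗᵢ[ℂ] FockSpace J ħ) (f₁ f₂ : FockSpace J ħ) :
    FockSpace.ip (U f₁) (U f₂) = FockSpace.ip f₁ f₂ :=
  U.inner_map_map f₂ f₁

theorem ip_conj (f₁ f₂ : FockSpace J ħ) :
    starRingEnd ℂ (FockSpace.ip f₁ f₂) = FockSpace.ip f₂ f₁ :=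
  inner_conj_symm f₁ f₂

theorem ip_smul_right (c : ℂ) (f₁ f₂ : FockSpace J ħ) :
    FockSpace.ip f₁ (c • f₂) = starRingEnd ℂ c * FockSpace.ip f₁ f₂ :=
  inner_smul_left f₂ f₁ c

/-- The coherent states are the translates of the constant function, up to a factor. -/
theorem rep_coherent_zero (v : CVec J) :
    rep J ħ ⟨v.toV, 0⟩ (coherent J ħ 0)
      = Complex.exp (-(J.herm v v / (4 * ħ))) • coherent J ħ v := by
  ext z
  rw [rep_apply, coherent_zero_apply, FockSpace.smul_apply, coherent_apply, multiplier,
    CVec.of_toV, norm_sq_eq_herm, ← Complex.exp_add, mul_one]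
  congr 1
  push_cast
  ring

/-- The reproducing property, obtained at `v` from that at `0` by translation. -/
theorem ip_coherent (f : FockSpace J ħ) (v : CVec J) :
    FockSpace.ip f (coherent J ħ v) = f v := by
  set c := Complex.exp (-(J.herm v v / (4 * ħ))) with hc
  have hc0 : c ≠ 0 := Complex.exp_ne_zero _
  have h := ip_isometry (rep J ħ ⟨v.toV, 0⟩) ((rep J ħ ⟨v.toV, 0⟩⁻¹) f) (coherent J ħ 0)
  have e : rep J ħ ⟨v.toV, 0⟩ ((rep J ħ ⟨v.toV, 0⟩⁻¹) f) = f := by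
    rw [map_inv]
    exact (rep J ħ ⟨v.toV, 0⟩).apply_symm_apply f
  rw [e, rep_coherent_zero, ip_smul_right, ip_coherent_zero, rep_apply, multiplier] at h
  have hcc : starRingEnd ℂ c = c := by
    rw [hc, ← Complex.exp_conj]
    simp [J.herm_conj, map_ofNat]
  have hcm : ∀ w : CVec J, J.herm 0 w = 0 := fun w => by rw [← CVec.inner_eq, inner_zero_right]
  have hv : CVec.of J (⟨v.toV, 0⟩⁻¹ : Heisenberg Ω).vec = -v := by
    simp
  rw [hcc, hv, hcm, norm_neg, norm_sq_eq_herm, zero_sub, neg_neg] at h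
  refine mul_left_cancel₀ hc0 (h.trans ?_)
  congr 1
  rw [hc]
  congr 1
  simp

end Fock

/-! ### The linear and antilinear parts of a symplectic transformation -/

section Sympl

variable {V : Type*} [AddCommGroup V] [Module ℝ V] {Ω : SymplecticForm V}

theorem Sp.apply_inv_apply (g : Sp Ω) (x : V) :
    (g : V ≃ₗ[ℝ] V) (((g⁻¹ : Sp Ω) : V ≃ₗ[ℝ] V) x) = x :=
  (g : V ≃ₗ[ℝ] V).apply_symm_apply x

theorem Sp.inv_apply_apply (g : Sp Ω) (x : V) :
    ((g⁻¹ : Sp Ω) : V ≃ₗ[ℝ] V) ((g : V ≃ₗ[ℝ] V) x) = x :=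
  (g : V ≃ₗ[ℝ] V).symm_apply_apply x

theorem Sp.form_apply_left (g : Sp Ω) (x y : V) :
    Ω.form ((g : V ≃ₗ[ℝ] V) x) y = Ω.form x (((g⁻¹ : Sp Ω) : V ≃ₗ[ℝ] V) y) := by
  have h := g.2 x (((g⁻¹ : Sp Ω) : V ≃ₗ[ℝ] V) y)
  rwa [Sp.apply_inv_apply] at h

/-- In matrices `gᵀ Ω g = Ω`, with `Ω` invertible. -/
theorem Sp.abs_det [FiniteDimensional ℝ V] (g : Sp Ω) :
    |LinearMap.det ((g : V ≃ₗ[ℝ] V) : V →ₗ[ℝ] V)| = 1 := by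
  classical
  set b := Module.finBasis ℝ V
  set l : V →ₗ[ℝ] V := ((g : V ≃ₗ[ℝ] V) : V →ₗ[ℝ] V)
  have hB : Ω.form.comp l l = Ω.form := by
    ext x y
    exact g.2 x y
  have h0 : (LinearMap.BilinForm.toMatrix b Ω.form).det ≠ 0 :=
    (LinearMap.BilinForm.nondegenerate_iff_det_ne_zero b).mp Ω.nondegenerate
  have h := congrArg Matrix.det (LinearMap.BilinForm.toMatrix_comp b b Ω.form l l)
  rw [hB, Matrix.det_mul, Matrix.det_mul, Matrix.det_transpose, LinearMap.det_toMatrix] at h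
  have h2 : LinearMap.det l * LinearMap.det l = 1 := by
    apply mul_right_cancel₀ h0
    linear_combination -h
  rcases mul_self_eq_one_iff.mp h2 with h3 | h3 <;> simp [h3]

end Sympl

section Parts

variable {V : Type*} [AddCommGroup V] [Module ℝ V] {Ω : SymplecticForm V} {J : PCCS Ω}

theorem herm_add_right (u v w : CVec J) : J.herm u (v + w) = J.herm u v + J.herm u w := by
  simp only [← CVec.inner_eq, inner_add_left]

theorem herm_sub_left (u v w : CVec J) : J.herm (u - v) w = J.herm u w - J.herm v w := by
  simp only [← CVec.inner_eq, inner_sub_right]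

theorem herm_sub_right (u v w : CVec J) : J.herm u (v - w) = J.herm u v - J.herm u w := by
  simp only [← CVec.inner_eq, inner_sub_left]

theorem herm_neg_right (u v : CVec J) : J.herm u (-v) = -J.herm u v := by
  simp only [← CVec.inner_eq, inner_neg_left]

theorem herm_smul_right (c : ℂ) (u v : CVec J) :
    J.herm u (c • v) = starRingEnd ℂ c * J.herm u v := by
  simp only [← CVec.inner_eq, inner_smul_left]

theorem toV_cPart (g : V ≃ₗ[ℝ] V) (x : CVec J) :
    (cPart J g x).toV = (1 / 2 : ℝ) • (g x.toV - J.j (g (J.j x.toV))) := rfl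

theorem toV_dPart (g : V ≃ₗ[ℝ] V) (x : CVec J) :
    (dPart J g x).toV = (1 / 2 : ℝ) • (g x.toV + J.j (g (J.j x.toV))) := rfl

theorem cPart_add_dPart (g : V ≃ₗ[ℝ] V) (x : CVec J) :
    cPart J g x + dPart J g x = CVec.of J (g x.toV) := by
  apply CVec.toV_injective
  rw [CVec.toV_add, toV_cPart, toV_dPart, CVec.toV_of]
  module

/-- If `(L + M) ∘ g` is antilinear, where `L` is linear and `M` antilinear, then its complex linear
part `L ∘ C_g + M ∘ D_g` vanishes. -/
theorem linear_part_eq_zero {L : CVec J →ₗ[ℂ] ℂ} {M N : CVec J →ₗ⋆[ℂ] ℂ} {g : V ≃ₗ[ℝ] V}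
    (h : ∀ u : CVec J, L (CVec.of J (g u.toV)) + M (CVec.of J (g u.toV)) = N u) (u : CVec J) :
    L (cPart J g u) + M (dPart J g u) = 0 := by
  have h1 := h u
  have h2 := h (Complex.I • u)
  simp only [← cPart_add_dPart, map_add, map_smul, LinearMap.map_smulₛₗ, Complex.conj_I,
    smul_eq_mul, neg_mul, map_neg, neg_neg] at h1 h2
  linear_combination (1 / 2 : ℂ) * h1 - (Complex.I / 2) * h2
    + (1 / 2 : ℂ) * (L (cPart J g u) - L (dPart J g u) - M (cPart J g u)
      + M (dPart J g u) + N u) * Complex.I_sq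

theorem cPart_cPart_inv_add (g : Sp Ω) (x : CVec J) :
    cPart J g (cPart J (g⁻¹ : Sp Ω) x) + dPart J g (dPart J (g⁻¹ : Sp Ω) x) = x := by
  apply CVec.toV_injective
  simp only [CVec.toV_add, toV_cPart, toV_dPart, map_smul, map_sub, map_add, map_neg, J.sq,
    Sp.apply_inv_apply]
  module

theorem cPart_dPart_inv_add (g : Sp Ω) (x : CVec J) :
    cPart J g (dPart J (g⁻¹ : Sp Ω) x) + dPart J g (cPart J (g⁻¹ : Sp Ω) x) = 0 := by
  apply CVec.toV_injective
  simp only [CVec.toV_add, toV_cPart, toV_dPart, map_smul, map_sub, map_add, map_neg, J.sq,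
    Sp.apply_inv_apply, CVec.toV_zero]
  module

/-- The Hermitian adjoint of `C_g` is `C_{g⁻¹}`. -/
theorem herm_cPart_left (g : Sp Ω) (x y : CVec J) :
    J.herm (cPart J g x) y = J.herm x (cPart J (g⁻¹ : Sp Ω) y) := by
  simp only [PCCS.herm, toV_cPart, map_smul, map_sub, LinearMap.smul_apply, LinearMap.sub_apply,
    J.j_left, J.sq, map_neg, Sp.form_apply_left, smul_eq_mul]
  push_cast
  ring

/-- The adjoint of `D_g` with respect to the real inner product is `-D_{g⁻¹}`; for antilinear maps
this takes the following form. -/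
theorem herm_dPart_left (g : Sp Ω) (x y : CVec J) :
    J.herm (dPart J g x) y = -J.herm (dPart J (g⁻¹ : Sp Ω) y) x := by
  rw [← J.herm_conj x]
  simp only [PCCS.herm, toV_dPart, map_smul, map_add, LinearMap.smul_apply, LinearMap.add_apply,
    J.j_left, J.sq, map_neg, Sp.form_apply_left, map_sub, map_mul,
    Complex.conj_ofReal, Complex.conj_I, smul_eq_mul]
  push_cast
  ring

theorem norm_dPart_lt_norm_cPart (g : Sp Ω) {x : CVec J} (hx : x ≠ 0) :
    ‖dPart J g x‖ < ‖cPart J g x‖ := by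
  have h := congrArg (J.herm x) (cPart_cPart_inv_add g⁻¹ x)
  rw [herm_add_right, inv_inv, ← herm_cPart_left, ← J.herm_conj _ x, herm_dPart_left, inv_inv,
    map_neg, J.herm_conj, ← norm_sq_eq_herm, ← norm_sq_eq_herm, ← norm_sq_eq_herm] at h
  -- This is `|C_g x|² - |D_g x|² = |x|²`.
  have h' : ‖cPart J (g : V ≃ₗ[ℝ] V) x‖ ^ 2 + -‖dPart J (g : V ≃ₗ[ℝ] V) x‖ ^ 2 = ‖x‖ ^ 2 := by
    exact_mod_cast h
  have hp : 0 < ‖x‖ := norm_pos_iff.mpr hx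
  exact lt_of_pow_lt_pow_left₀ 2 (norm_nonneg _) (by nlinarith)

variable [FiniteDimensional ℝ V]

@[simp] theorem cPart_cEquiv_symm (g : Sp Ω) (x : CVec J) :
    cPart J g ((cEquiv J g).symm x) = x :=
  (cEquiv J g).apply_symm_apply x

theorem cPart_zPart (g : Sp Ω) (x : CVec J) : cPart J g (zPart J g x) = dPart J g x :=
  cPart_cEquiv_symm g _

/-- `Z_{g⁻¹} = -D_g C_g⁻¹`, which turns left quotients into right quotients. -/
theorem zPart_inv_cPart (g : Sp Ω) (x : CVec J) :
    zPart J g⁻¹ (cPart J g x) = -dPart J g x := by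
  apply cPart_injective J g⁻¹
  have h := cPart_dPart_inv_add g⁻¹ x
  rw [inv_inv] at h
  rw [cPart_zPart, map_neg]
  exact (neg_eq_of_add_eq_zero_right h).symm

theorem herm_cEquiv_symm_left (g : Sp Ω) (x y : CVec J) :
    J.herm ((cEquiv J g).symm x) y = J.herm x ((cEquiv J g⁻¹).symm y) := by
  have h := herm_cPart_left g ((cEquiv J g).symm x) ((cEquiv J g⁻¹).symm y)
  rw [cPart_cEquiv_symm, cPart_cEquiv_symm] at h
  exact h.symm

/-- `Z_g` is symmetric: `⟨x, Z_g y⟩_j` is a symmetric complex bilinear form. -/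
theorem herm_zPart_comm (g : Sp Ω) (x y : CVec J) :
    J.herm x (zPart J g y) = J.herm y (zPart J g x) := by
  -- Write the arguments as values of `C_{g⁻¹}`, on which `Z_g` is `-D_{g⁻¹}`.
  obtain ⟨a, rfl⟩ : ∃ a, cPart J (g⁻¹ : Sp Ω) a = x := ⟨_, cPart_cEquiv_symm g⁻¹ x⟩
  obtain ⟨b, rfl⟩ : ∃ b, cPart J (g⁻¹ : Sp Ω) b = y := ⟨_, cPart_cEquiv_symm g⁻¹ y⟩
  have hz := fun c : CVec J => zPart_inv_cPart g⁻¹ c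
  rw [inv_inv] at hz
  rw [hz, hz, herm_neg_right, herm_neg_right, neg_inj, herm_cPart_left, inv_inv,
    eq_neg_of_add_eq_zero_left (cPart_dPart_inv_add g b), herm_neg_right, ← J.herm_conj _ a,
    herm_dPart_left, map_neg, neg_neg, J.herm_conj]

/-- `1 + Z_g = C_g⁻¹ g`. -/
theorem add_zPart (g : Sp Ω) (x : CVec J) :
    x + zPart J g x = (cEquiv J g).symm (CVec.of J ((g : V ≃ₗ[ℝ] V) x.toV)) := by
  apply cPart_injective J g
  rw [map_add, cPart_zPart, cPart_cEquiv_symm, cPart_add_dPart]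

/-- `Z_g` is `-D_{g⁻¹} C_{g⁻¹}⁻¹`, and `D` is strictly smaller than `C`. -/
theorem norm_zPart_lt (g : Sp Ω) {x : CVec J} (hx : x ≠ 0) : ‖zPart J g x‖ < ‖x‖ := by
  obtain ⟨a, rfl⟩ : ∃ a, cPart J (g⁻¹ : Sp Ω) a = x := ⟨_, cPart_cEquiv_symm g⁻¹ x⟩
  have hz := zPart_inv_cPart g⁻¹ a
  rw [inv_inv] at hz
  rw [hz, norm_neg]
  exact norm_dPart_lt_norm_cPart _ fun h => hx (by rw [h, map_zero])

/-- The identity of exponents behind the formula for the Berezin kernel. -/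
theorem kernel_exponent (g : Sp Ω) (z w : CVec J) :
    J.herm w w + 2 * J.herm z (CVec.of J ((g : V ≃ₗ[ℝ] V) w.toV))
        - J.herm (CVec.of J ((g : V ≃ₗ[ℝ] V) w.toV)) (CVec.of J ((g : V ≃ₗ[ℝ] V) w.toV))
        - J.herm (z - CVec.of J ((g : V ≃ₗ[ℝ] V) w.toV))
            (zPart J g⁻¹ (z - CVec.of J ((g : V ≃ₗ[ℝ] V) w.toV)))
      = 2 * J.herm ((cEquiv J g).symm z) w - J.herm z (zPart J g⁻¹ z)
        - J.herm (zPart J g w) w := by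
  set y := CVec.of J ((g : V ≃ₗ[ℝ] V) w.toV) with hy
  have h1 : y + zPart J g⁻¹ y = (cEquiv J g⁻¹).symm w := by
    rw [add_zPart, hy, CVec.toV_of, Sp.inv_apply_apply, CVec.of_toV]
  have h2 := herm_cEquiv_symm_left g z w
  have h3 := herm_cEquiv_symm_left g y w
  rw [← add_zPart, J.herm_add_left] at h3
  rw [← h1, herm_add_right] at h2 h3
  rw [h2, map_sub, herm_sub_left, herm_sub_right, herm_sub_right, herm_zPart_comm g⁻¹ y z]
  linear_combination h3

/-! ### The real determinant of `1 + Z_g` -/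

/-- The real linear map `1 + Z_g`. -/
def oneAddZ (J : PCCS Ω) (g : Sp Ω) : CVec J →ₗ[ℝ] CVec J where
  toFun x := x + zPart J g x
  map_add' x y := by rw [map_add]; abel
  map_smul' r x := by
    have h : zPart J g (r • x) = r • zPart J g x := by
      rw [← Complex.coe_smul, LinearMap.map_smulₛₗ, Complex.conj_ofReal, Complex.coe_smul]
    rw [h, RingHom.id_apply, smul_add]

theorem oneAddZ_apply (g : Sp Ω) (x : CVec J) : oneAddZ J g x = x + zPart J g x := rfl

theorem inner_oneAddZ_self (g : Sp Ω) (x : CVec J) :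
    inner ℝ (oneAddZ J g x) x = ‖x‖ ^ 2 + (J.herm x (zPart J g x)).re := by
  rw [oneAddZ_apply, inner_add_left, real_inner_self_eq_norm_sq]
  rfl

theorem oneAddZ_isSymmetric (g : Sp Ω) : (oneAddZ J g).IsSymmetric := by
  intro x y
  have h : inner ℝ (zPart J g x) y = inner ℝ (zPart J g y) x :=
    congrArg Complex.re (herm_zPart_comm g y x)
  rw [oneAddZ_apply, oneAddZ_apply, inner_add_left, inner_add_right, h, real_inner_comm x]

theorem inner_oneAddZ_self_pos (g : Sp Ω) (x : CVec J) (hx : x ≠ 0) :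
    0 < inner ℝ (oneAddZ J g x) x := by
  rw [oneAddZ_apply, inner_add_left, real_inner_self_eq_norm_sq]
  have h1 := neg_le_of_abs_le (abs_real_inner_le_norm (zPart J g x) x)
  have h2 := norm_zPart_lt g hx
  have h3 : 0 < ‖x‖ := norm_pos_iff.mpr hx
  nlinarith

/-- The real determinants in `C_g (1 + Z_g) = g`. -/
theorem abs_det_oneAddZ (g : Sp Ω) :
    |LinearMap.det (oneAddZ J g)| * ‖LinearMap.det (cPart J (g : V ≃ₗ[ℝ] V))‖ ^ 2 = 1 := by
  let e : V ≃ₗ[ℝ] CVec J := LinearEquiv.ofBijective (CVec.ofₗ J) (CVec.of J).bijective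
  have h : (cPart J (g : V ≃ₗ[ℝ] V)).restrictScalars ℝ ∘ₗ oneAddZ J g
      = (e : V →ₗ[ℝ] CVec J) ∘ₗ ((g : V ≃ₗ[ℝ] V) : V →ₗ[ℝ] V) ∘ₗ (e.symm : CVec J →ₗ[ℝ] V) := by
    ext x
    obtain ⟨v, rfl⟩ := e.surjective x
    simp only [LinearMap.comp_apply, LinearMap.restrictScalars_apply, oneAddZ_apply,
      LinearEquiv.coe_coe, e.symm_apply_apply]
    rw [add_zPart, cPart_cEquiv_symm]
    rfl
  have h2 := congrArg (fun l => |LinearMap.det l|) h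
  simp only [LinearMap.det_comp, LinearMap.det_conj, abs_mul, Sp.abs_det,
    LinearMap.det_restrictScalars, Algebra.norm_complex_apply, Complex.normSq_eq_norm_sq,
    abs_pow, abs_norm] at h2
  rw [mul_comm]
  exact h2

/-- `C_{g⁻¹} = C_g*`, so that the determinants are conjugate. -/
theorem norm_det_cPart_inv (g : Sp Ω) :
    ‖LinearMap.det (cPart J ((g⁻¹ : Sp Ω) : V ≃ₗ[ℝ] V))‖
      = ‖LinearMap.det (cPart J (g : V ≃ₗ[ℝ] V))‖ := by
  have h : cPart J ((g⁻¹ : Sp Ω) : V ≃ₗ[ℝ] V) = LinearMap.adjoint (cPart J (g : V ≃ₗ[ℝ] V)) := by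
    rw [LinearMap.eq_adjoint_iff]
    intro x y
    rw [CVec.inner_eq, CVec.inner_eq, herm_cPart_left]
  set b := stdOrthonormalBasis ℂ (CVec J)
  rw [h, ← LinearMap.det_toMatrix b.toBasis, LinearMap.toMatrix_adjoint b b,
    Matrix.det_conjTranspose, LinearMap.det_toMatrix, norm_star]

end Parts

/-! ### The Berezin kernel of an element of `Mp^c` -/

section Kernel

variable {V : Type*} [AddCommGroup V] [Module ℝ V] [FiniteDimensional ℝ V]
  {Ω : SymplecticForm V} {J : PCCS Ω} {ħ : ℝ} [Fact (0 < ħ)]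

/-- Applying the intertwining relation to `e_0` expresses all `U e_w` through `U e_0`. -/
theorem apply_coherent_of_mem_Mpc {U : FockSpace J ħ ≃ₗᵢ[ℂ] FockSpace J ħ} {g : Sp Ω}
    (hUg : (U, g) ∈ Mpc J ħ) (z w : CVec J) :
    U (coherent J ħ w) z
      = Complex.exp (1 / (4 * ħ) *
          (J.herm w w + 2 * J.herm z (CVec.of J ((g : V ≃ₗ[ℝ] V) w.toV))
            - J.herm (CVec.of J ((g : V ≃ₗ[ℝ] V) w.toV)) (CVec.of J ((g : V ≃ₗ[ℝ] V) w.toV))))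
        * U (coherent J ħ 0) (z - CVec.of J ((g : V ≃ₗ[ℝ] V) w.toV)) := by
  have h1 : rep J ħ (g • ⟨w.toV, 0⟩) = U * rep J ħ ⟨w.toV, 0⟩ * U⁻¹ := hUg _
  have h2 : rep J ħ (g • ⟨w.toV, 0⟩) (U (coherent J ħ 0))
      = U (rep J ħ ⟨w.toV, 0⟩ (coherent J ħ 0)) := by
    rw [h1]
    change U (rep J ħ ⟨w.toV, 0⟩ (U.symm (U (coherent J ħ 0)))) = _
    rw [U.symm_apply_apply]
  rw [rep_coherent_zero, U.map_smul] at h2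
  have h3 := congrArg (fun f : FockSpace J ħ => f z) h2
  simp only [FockSpace.smul_apply] at h3
  rw [rep_apply, Heisenberg.smul_def, multiplier, norm_sq_eq_herm] at h3
  refine mul_left_cancel₀ (Complex.exp_ne_zero (-(J.herm w w / (4 * ħ)))) (h3.symm.trans ?_)
  rw [← mul_assoc, ← Complex.exp_add]
  congr 2
  have : (ħ : ℂ) ≠ 0 := by exact_mod_cast (Fact.out : 0 < ħ).ne'
  push_cast
  field_simp
  ring

/-- The Berezin kernel of a unitary operator is antiholomorphic in its second variable. -/
theorem apply_coherent_eq_conj (U : FockSpace J ħ ≃ₗᵢ[ℂ] FockSpace J ħ) (z w : CVec J) :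
    U (coherent J ħ w) z = starRingEnd ℂ (U.symm (coherent J ħ z) w) := by
  rw [← ip_coherent, ← ip_coherent (U.symm _), ip_conj,
    ← ip_isometry U (coherent J ħ w), U.apply_symm_apply]

/-- `φ = U e_0` satisfies `dφ_z(x) = -⟨z, Z_{g⁻¹} x⟩_j φ(z) / 2ħ`. -/
theorem fderiv_apply_coherent_zero {U : FockSpace J ħ ≃ₗᵢ[ℂ] FockSpace J ħ} {g : Sp Ω}
    (hUg : (U, g) ∈ Mpc J ħ) (z x : CVec J) :
    fderiv ℂ (U (coherent J ħ 0)) z x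
      = -(1 / (2 * ħ) * J.herm z (zPart J g⁻¹ x)) * U (coherent J ħ 0) z := by
  set φ : FockSpace J ħ := U (coherent J ħ 0) with hφ
  set f : FockSpace J ħ := U.symm (coherent J ħ z) with hf
  let M : CVec J →ₗ⋆[ℂ] ℂ :=
    { toFun := fun u => 1 / (2 * ħ) * J.herm z u * φ z
      map_add' := fun u v => by rw [herm_add_right]; ring
      map_smul' := fun c u => by rw [herm_smul_right, smul_eq_mul]; ring }
  let N : CVec J →ₗ⋆[ℂ] ℂ :=
    { toFun := fun u => starRingEnd ℂ (fderiv ℂ f 0 u)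
      map_add' := fun u v => by rw [map_add, map_add]
      map_smul' := fun c u => by rw [map_smul, smul_eq_mul, map_mul, smul_eq_mul] }
  let L : CVec J →ₗ[ℂ] ℂ := -(fderiv ℂ φ z : CVec J →ₗ[ℂ] ℂ)
  have key : ∀ u : CVec J, L (CVec.of J ((g : V ≃ₗ[ℝ] V) u.toV))
      + M (CVec.of J ((g : V ≃ₗ[ℝ] V) u.toV)) = N u := by
    intro u
    set y := CVec.of J ((g : V ≃ₗ[ℝ] V) u.toV) with hy
    -- Both sides are the derivative at `t = 0` of `t ↦ (U e_{tu})(z)`.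
    have hN : HasDerivAt (fun t : ℝ => U (coherent J ħ ((t : ℂ) • u)) z) (N u) 0 := by
      have h0 : HasFDerivAt (f : CVec J → ℂ) (fderiv ℂ f 0) (((0 : ℝ) : ℂ) • u) := by
        rw [Complex.ofReal_zero, zero_smul]
        exact (f.differentiable 0).hasFDerivAt
      have h1 : HasDerivAt (fun t : ℝ => (t : ℂ) • u) ((1 : ℂ) • u) 0 :=
        (Complex.ofRealCLM.hasDerivAt (x := (0 : ℝ))).smul_const u
      have h2 := ((h0.restrictScalars ℝ).comp_hasDerivAt (0 : ℝ) h1).star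
      rw [one_smul] at h2
      exact h2.congr_of_eventuallyEq
        (Filter.Eventually.of_forall fun t => apply_coherent_eq_conj U z _)
    have hLM : HasDerivAt (fun t : ℝ => U (coherent J ħ ((t : ℂ) • u)) z) (L y + M y) 0 := by
      have hyt : ∀ t : ℝ, CVec.of J ((g : V ≃ₗ[ℝ] V) ((t : ℂ) • u).toV) = (t : ℂ) • y := by
        intro t
        apply CVec.toV_injective
        simp only [CVec.toV_of, CVec.toV_smul, Complex.ofReal_re, Complex.ofReal_im, zero_smul,
          add_zero, map_smul, hy]
      have h0 : HasFDerivAt (φ : CVec J → ℂ) (fderiv ℂ φ z) (z - ((0 : ℝ) : ℂ) • y) := by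
        rw [Complex.ofReal_zero, zero_smul, sub_zero]
        exact (φ.differentiable z).hasFDerivAt
      have h1 : HasDerivAt (fun t : ℝ => z - (t : ℂ) • y) (-((1 : ℂ) • y)) 0 :=
        ((Complex.ofRealCLM.hasDerivAt (x := (0 : ℝ))).smul_const y).const_sub z
      have h2 := (h0.restrictScalars ℝ).comp_hasDerivAt (0 : ℝ) h1
      have ht : HasDerivAt (fun t : ℝ => (t : ℂ)) 1 0 :=
        Complex.ofRealCLM.hasDerivAt (x := (0 : ℝ))
      have h3 : HasDerivAt (fun t : ℝ => Complex.exp (1 / (2 * ħ) * J.herm z y * (t : ℂ)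
          + 1 / (4 * ħ) * (J.herm u u - J.herm y y) * (t : ℂ) ^ 2))
          (1 / (2 * ħ) * J.herm z y) 0 := by
        have h := ((ht.const_mul (1 / (2 * ħ) * J.herm z y)).add
          ((ht.pow 2).const_mul (1 / (4 * ħ) * (J.herm u u - J.herm y y)))).cexp
        simpa using h
      have h4 := h3.mul h2
      refine (h4.congr_of_eventuallyEq (Filter.Eventually.of_forall fun t => ?_)).congr_deriv ?_
      · rw [apply_coherent_of_mem_Mpc hUg, hyt, Pi.mul_apply, Function.comp_apply]
        congr 2
        simp only [herm_smul_right, J.herm_smul_left, Complex.conj_ofReal]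
        ring
      · have hL : L y = -fderiv ℂ φ z y := rfl
        have hM : M y = 1 / (2 * ħ) * J.herm z y * φ z := rfl
        simp only [hL, hM, Function.comp_apply, ContinuousLinearMap.coe_restrictScalars', one_smul,
          map_neg, Complex.ofReal_zero, mul_zero, ne_eq, OfNat.ofNat_ne_zero, not_false_eq_true,
          zero_pow, add_zero, Complex.exp_zero, zero_smul, sub_zero]
        ring
    exact hLM.unique hN
  -- At `u = C_g⁻¹ x` the complex linear part involves `D_g C_g⁻¹ x = -Z_{g⁻¹} x`.
  have h := linear_part_eq_zero key ((cEquiv J g).symm x)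
  have hz := zPart_inv_cPart g ((cEquiv J g).symm x)
  rw [cPart_cEquiv_symm] at h hz
  rw [eq_neg_iff_add_eq_zero.mpr (neg_eq_iff_add_eq_zero.mp hz.symm)] at h
  have h' : -(fderiv ℂ φ z x) + 1 / (2 * ħ) * J.herm z (-(zPart J g⁻¹ x)) * φ z = 0 := h
  rw [herm_neg_right] at h'
  linear_combination -h'

/-- `U e_0` is a Gaussian: the differential equation is integrated along the ray through `z`. -/
theorem apply_coherent_zero {U : FockSpace J ħ ≃ₗᵢ[ℂ] FockSpace J ħ} {g : Sp Ω}
    (hUg : (U, g) ∈ Mpc J ħ) (z : CVec J) :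
    U (coherent J ħ 0) z = U (coherent J ħ 0) 0 *
      Complex.exp (-(1 / (4 * ħ) * J.herm z (zPart J g⁻¹ z))) := by
  set φ : FockSpace J ħ := U (coherent J ħ 0) with hφ
  set a : ℂ := 1 / (4 * ħ) * J.herm z (zPart J g⁻¹ z) with ha
  have hd : ∀ t : ℂ, HasDerivAt (fun t : ℂ => φ (t • z) * Complex.exp (a * t ^ 2)) 0 t := by
    intro t
    have h1 := (φ.differentiable (t • z)).hasFDerivAt.comp_hasDerivAt t
      ((hasDerivAt_id t).smul_const z)
    have h2 := (((hasDerivAt_id t).pow 2).const_mul a).cexp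
    refine (h1.mul h2).congr_deriv ?_
    rw [one_smul, fderiv_apply_coherent_zero hUg, J.herm_smul_left, ← hφ]
    simp only [Function.comp_apply, id, Pi.pow_apply, ha]
    have : (ħ : ℂ) ≠ 0 := by exact_mod_cast (Fact.out : 0 < ħ).ne'
    field_simp
    push_cast
    ring
  have h := is_const_of_deriv_eq_zero (fun t => (hd t).differentiableAt)
    (fun t => (hd t).deriv) 1 0
  simp only [one_smul, zero_smul, one_pow, mul_one, ne_eq, OfNat.ofNat_ne_zero, not_false_eq_true,
    zero_pow, mul_zero, Complex.exp_zero] at h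
  rw [← h, mul_assoc, ← Complex.exp_add, add_neg_cancel, Complex.exp_zero, mul_one]

/-! ### The normalisation -/

/-- Comparison of `‖U e_0‖ = ‖e_0‖ = 1` with the Gaussian integral of `|U e_0|²`. -/
theorem norm_sq_mul_det {U : FockSpace J ħ ≃ₗᵢ[ℂ] FockSpace J ħ} {g : Sp Ω}
    (hUg : (U, g) ∈ Mpc J ħ) :
    ‖U (coherent J ħ 0) 0 ^ 2 * LinearMap.det (cPart J (g : V ≃ₗ[ℝ] V))‖ = 1 := by
  have hħ : 0 < ħ := Fact.out
  set lam := U (coherent J ħ 0) 0 with hlam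
  set S := oneAddZ J g⁻¹ with hS
  set I := ∫ z : CVec J, Real.exp (-(1 / (2 * ħ)) * inner ℝ (S z) z) with hI
  have h1 : ‖U (coherent J ħ 0)‖ ^ 2 = 1 := by
    rw [U.norm_map, FockSpace.norm_sq]
    simpa using normConst_mul_integral_weight (J := J) hħ
  have h2 : ∀ z : CVec J, ‖U (coherent J ħ 0) z‖ ^ 2 * weight J ħ z
      = ‖lam‖ ^ 2 * Real.exp (-(1 / (2 * ħ)) * inner ℝ (S z) z) := by
    intro z
    have e : (-(1 / (4 * ħ) * J.herm z (zPart J g⁻¹ z))).re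
        = -(1 / (4 * ħ) * (J.herm z (zPart J g⁻¹ z)).re) := by
      rw [Complex.neg_re, ← Complex.re_ofReal_mul]
      push_cast
      rfl
    rw [apply_coherent_zero hUg, norm_mul, mul_pow, Complex.norm_exp, e, weight,
      ← Real.exp_nat_mul, mul_assoc, ← Real.exp_add, inner_oneAddZ_self]
    congr 2
    push_cast
    field_simp
    ring
  rw [FockSpace.norm_sq] at h1
  simp only [h2] at h1
  rw [integral_const_mul, ← hI] at h1
  have h3 := integral_exp_neg_inner (oneAddZ_isSymmetric (J := J) g⁻¹)
    (inner_oneAddZ_self_pos g⁻¹) (b := 1 / (2 * ħ)) (by positivity)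
  rw [← hS, ← hI, finrank_real_of_complex,
    show Real.pi / (1 / (2 * ħ)) = 2 * Real.pi * ħ by field_simp, mul_comm (2 : ℕ), pow_mul] at h3
  have h4 := abs_det_oneAddZ (J := J) g⁻¹
  rw [norm_det_cPart_inv, ← hS] at h4
  have h5 : normConst J ħ * (2 * Real.pi * ħ) ^ Module.finrank ℂ (CVec J) = 1 :=
    inv_mul_cancel₀ (by positivity)
  set P := (2 * Real.pi * ħ) ^ Module.finrank ℂ (CVec J)
  set c := normConst J ħ
  set s := |LinearMap.det S|
  set d := ‖LinearMap.det (cPart J (g : V ≃ₗ[ℝ] V))‖ with hd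
  rw [norm_mul, norm_pow, ← hd]
  have h6 : (‖lam‖ ^ 2 * d) ^ 2 = 1 := by
    calc (‖lam‖ ^ 2 * d) ^ 2 = (‖lam‖ ^ 2) ^ 2 * d ^ 2 * (c * P) ^ 2 := by rw [h5]; ring
      _ = (‖lam‖ ^ 2) ^ 2 * d ^ 2 * c ^ 2 * P ^ 2 := by ring
      _ = (c * (‖lam‖ ^ 2 * I)) ^ 2 * (s * d ^ 2) := by rw [← h3]; ring
      _ = 1 := by rw [h1, h4]; norm_num
  exact (pow_eq_one_iff_of_nonneg (by positivity) two_ne_zero).mp h6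

end Kernel

end MpcFock

end

theorem mainTheorem4 {V : Type*} [AddCommGroup V] [Module ℝ V] [FiniteDimensional ℝ V]
    (Ω : MpcFock.SymplecticForm V) (J : MpcFock.PCCS Ω) (ħ : ℝ) [Fact (0 < ħ)]
    (U : MpcFock.FockSpace J ħ ≃ₗᵢ[ℂ] MpcFock.FockSpace J ħ) (g : MpcFock.Sp Ω)
    (hUg : (U, g) ∈ MpcFock.Mpc J ħ) :
    ∃ lam : ℂ,
      (∀ z v : MpcFock.CVec J,
        MpcFock.berezinKernel J ħ U.toLinearEquiv.toLinearMap z v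
          = lam * Complex.exp (1 / (4 * ħ) *
              (2 * J.herm ((MpcFock.cEquiv J g).symm z) v
                - J.herm z (MpcFock.zPart J g⁻¹ z)
                - J.herm (MpcFock.zPart J g v) v))) ∧
      ‖lam ^ 2 * LinearMap.det (MpcFock.cPart J g)‖ = 1 ∧
      lam = U (MpcFock.coherent J ħ 0) 0 ∧
      lam = MpcFock.FockSpace.ip (U (MpcFock.coherent J ħ 0)) (MpcFock.coherent J ħ 0) := by
  refine ⟨U (MpcFock.coherent J ħ 0) 0, fun z v => ?_, MpcFock.norm_sq_mul_det hUg, rfl,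
    (MpcFock.ip_coherent_zero _).symm⟩
  change U (MpcFock.coherent J ħ v) z = _
  rw [MpcFock.apply_coherent_of_mem_Mpc hUg, MpcFock.apply_coherent_zero hUg, mul_left_comm,
    ← Complex.exp_add, ← MpcFock.kernel_exponent]
  congr 2
  ring
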